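/- Let $S$ be a scheme; all schemes and morphisms are over $S$, and products are over $S$. Let $G$ be a group scheme over $S$ that is flat and affine over $S$, acting on a separated $S$-scheme $X$; write $m,p\colon G\times X\to X$ for the action and the projection. Assume that $X$ has a covering by affine open subschemes $\{U_i\}$ such that each $U_i$ is $G$-invariant and admits a $G$-equivariant $S$-morphism $\sigma_i\colon U_i\to G$, where $G$ acts on itself by left multiplication. Then there exist an $S$-scheme $Z$ and an $S$-morphism $\pi\colon X\to Z$ such that: (a) $\pi$ is a universal categorical quotient of $X$ by $G$: one has $\pi m=\pi p$, and for every morphism of $S$-schemes $Z'\to Z$, the base change $\pi'\colon X'=X\times_Z Z'\to Z'$, with the induced action of $G$ on $X'$ and the corresponding $m',p'\colon G\times X'\to X'$, satisfies $\pi'm'=\pi'p'$ and every $S$-morphism $\psi\colon X'\to T$ with $\psi m'=\psi p'$ factors uniquely through $\pi'$; (b) $\pi$ is a Zariski locally trivial principal $G$-bundle: $\pi m=\pi p$, and $Z$ has an open covering $\{W_j\}$ such that for each $j$ there is a $G$-equivariant isomorphism $G\times W_j\simeq\pi^{-1}(W_j)$ over $W_j$, where $G$ acts on $G\times W_j$ by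 left multiplication on the first factor. -/

import Mathlib

open CategoryTheory Limits MonoidalCategory CartesianMonoidalCategory AlgebraicGeometry

universe u

noncomputable section

/-- For a group scheme `G` over `S`, the category of `G`-schemes: `S`-schemes with a left
`G`-action, and `G`-equivariant `S`-morphisms. -/
abbrev GScheme {S : Scheme.{u}} (G : Over S) [GrpObj G] := Mod (Over S) G

namespace GScheme

variable {S : Scheme.{u}} {G : Over S} [GrpObj G]

/-- The action morphism `m : G × X ⟶ X`. -/
abbrev act (X : GScheme G) : G ⊗ X.X ⟶ X.X := ModObj.smul (M := G) (X := X.X)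

/-- The projection morphism `p : G × X ⟶ X`. -/
abbrev proj (X : GScheme G) : G ⊗ X.X ⟶ X.X := snd G X.X

lemma one_act (X : GScheme G) : MonObj.one (X := G) ▷ X.X ≫ X.act = (λ_ X.X).hom :=
  ModObj.one_smul_self G X.X

lemma mul_act (X : GScheme G) :
    MonObj.mul (X := G) ▷ X.X ≫ X.act = (α_ G G X.X).hom ≫ G ◁ X.act ≫ X.act :=
  ModObj.mul_smul_self G X.X

/-- `G` acting on itself by left multiplication. -/
abbrev leftMul (G : Over S) [GrpObj G] : GScheme G := Mod.regular G

/-- `G × W` with `G` acting by left multiplication on the first factor. -/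
abbrev trivialGScheme (G : Over S) [GrpObj G] (W : Over S) : GScheme G where
  X := G ⊗ W
  mod :=
    { smul := (α_ G G W).inv ≫ MonObj.mul (X := G) ▷ W
      one_smul := by
        change MonObj.one (X := G) ▷ (G ⊗ W) ≫ (α_ G G W).inv ≫ MonObj.mul (X := G) ▷ W =
          (λ_ (G ⊗ W)).hom
        rw [associator_inv_naturality_left_assoc, ← comp_whiskerRight, MonObj.one_mul]
        monoidal
      mul_smul := by
        change MonObj.mul (X := G) ▷ (G ⊗ W) ≫ (α_ G G W).inv ≫ MonObj.mul (X := G) ▷ W =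
          (α_ G G (G ⊗ W)).hom ≫ G ◁ ((α_ G G W).inv ≫ MonObj.mul (X := G) ▷ W) ≫
            (α_ G G W).inv ≫ MonObj.mul (X := G) ▷ W
        rw [associator_inv_naturality_left_assoc, ← comp_whiskerRight, MonObj.mul_assoc]
        simp only [comp_whiskerRight, whiskerLeft_comp, Category.assoc]
        monoidal }

/-- An open subscheme, as a scheme over `S`. -/
abbrev openSub (X : Over S) (U : X.left.Opens) : Over S := Over.mk (U.ι ≫ X.hom)

/-- The inclusion of an open subscheme, as a morphism over `S`. -/
abbrev openIncl (X : Over S) (U : X.left.Opens) : openSub X U ⟶ X := Over.homMk U.ι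

instance (X : Over S) (U : X.left.Opens) : Mono (openIncl X U) :=
  (Over.forget S).mono_of_mono_map (inferInstanceAs (Mono U.ι))

/-- An open subscheme `U` of `X` is `G`-invariant if the action maps `G × U` into `U`. -/
def IsInvariant (X : GScheme G) (U : X.X.left.Opens) : Prop :=
  X.proj.left ⁻¹ᵁ U ≤ X.act.left ⁻¹ᵁ U

lemma range_act_subset (X : GScheme G) (U : X.X.left.Opens) (hU : X.IsInvariant U) :
    Set.range ((G ◁ openIncl X.X U) ≫ X.act).left ⊆ Set.range U.ι := by
  rw [Set.range_subset_iff]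
  intro y
  have hp : (X.proj).left ((G ◁ openIncl X.X U).left y) ∈ U := by
    rw [← Scheme.Hom.comp_apply, ← Over.comp_left, whiskerLeft_snd, Over.comp_left,
      Scheme.Hom.comp_apply]
    exact ((snd G (openSub X.X U)).left y).2
  rw [Scheme.Opens.range_ι, Over.comp_left, Scheme.Hom.comp_apply]
  exact hU hp

/-- The restriction `G × U ⟶ U` of the action to a `G`-invariant open subscheme. -/
def restrictAct (X : GScheme G) (U : X.X.left.Opens) (hU : X.IsInvariant U) :
    G ⊗ openSub X.X U ⟶ openSub X.X U :=
  Over.homMk (IsOpenImmersion.lift U.ι ((G ◁ openIncl X.X U) ≫ X.act).left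
      (X.range_act_subset U hU))
    ((IsOpenImmersion.lift_fac_assoc U.ι _ (X.range_act_subset U hU) X.X.hom).trans
      (Over.w ((G ◁ openIncl X.X U) ≫ X.act)))

lemma restrictAct_incl (X : GScheme G) (U : X.X.left.Opens) (hU : X.IsInvariant U) :
    X.restrictAct U hU ≫ openIncl X.X U = G ◁ openIncl X.X U ≫ X.act := by
  ext1
  exact IsOpenImmersion.lift_fac _ _ _

/-- A `G`-invariant open subscheme, as a `G`-scheme. -/
abbrev restrict (X : GScheme G) (U : X.X.left.Opens) (hU : X.IsInvariant U) : GScheme G where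
  X := openSub X.X U
  mod :=
    { smul := X.restrictAct U hU
      one_smul := by
        change MonObj.one (X := G) ▷ openSub X.X U ≫ X.restrictAct U hU = (λ_ (openSub X.X U)).hom
        rw [← cancel_mono (openIncl X.X U), Category.assoc, restrictAct_incl,
          ← whisker_exchange_assoc, one_act, leftUnitor_naturality]
      mul_smul := by
        change MonObj.mul (X := G) ▷ openSub X.X U ≫ X.restrictAct U hU =
          (α_ G G (openSub X.X U)).hom ≫ G ◁ X.restrictAct U hU ≫ X.restrictAct U hU
        rw [← cancel_mono (openIncl X.X U)]
        simp only [Category.assoc, restrictAct_incl]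
        rw [← whiskerLeft_comp_assoc, restrictAct_incl, ← whisker_exchange_assoc, mul_act]
        simp }

/-- `π : X ⟶ Z` is `G`-invariant: `π ∘ m = π ∘ p`. -/
def IsInvariantHom (X : GScheme G) {Z : Over S} (π : X.X ⟶ Z) : Prop :=
  X.act ≫ π = X.proj ≫ π

lemma IsInvariantHom.preimage {X : GScheme G} {Z : Over S} {π : X.X ⟶ Z}
    (h : X.IsInvariantHom π) (W : Z.left.Opens) : X.IsInvariant (π.left ⁻¹ᵁ W) := by
  unfold IsInvariant
  rw [← Scheme.Hom.comp_preimage, ← Scheme.Hom.comp_preimage, ← Over.comp_left, ← Over.comp_left]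
  exact (congrArg (fun q : G ⊗ X.X ⟶ Z => q.left ⁻¹ᵁ W) h).ge

/-- The base change `X ×_Z Z'` of an invariant morphism `π : X ⟶ Z`, with `G` acting
through `X`: `g (x, z') = (g x, z')`. -/
abbrev baseChange (X : GScheme G) {Z Z' : Over S} (π : X.X ⟶ Z) (h : X.IsInvariantHom π)
    (f : Z' ⟶ Z) : GScheme G where
  X := pullback π f
  mod :=
    { smul := pullback.lift (G ◁ pullback.fst π f ≫ X.act) (snd G _ ≫ pullback.snd π f) (by
        rw [Category.assoc, h, Category.assoc, ← pullback.condition]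
        simp [proj])
      one_smul := by
        change MonObj.one (X := G) ▷ pullback π f ≫ pullback.lift _ _ _ = (λ_ (pullback π f)).hom
        apply pullback.hom_ext
        · rw [Category.assoc, pullback.lift_fst, ← whisker_exchange_assoc, one_act,
            leftUnitor_naturality]
        · rw [Category.assoc, pullback.lift_snd]
          simp [leftUnitor_hom]
      mul_smul := by
        change MonObj.mul (X := G) ▷ pullback π f ≫ pullback.lift _ _ _ =
          (α_ G G (pullback π f)).hom ≫ G ◁ pullback.lift _ _ _ ≫ pullback.lift _ _ _
        apply pullback.hom_ext
        · simp only [Category.assoc, pullback.lift_fst]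
          rw [← whiskerLeft_comp_assoc, pullback.lift_fst, ← whisker_exchange_assoc, mul_act]
          simp
        · simp only [Category.assoc, pullback.lift_snd]
          rw [whiskerLeft_snd_assoc, pullback.lift_snd]
          simp }

/-- `π : X ⟶ Z` is a categorical quotient of `X` by `G`: it is invariant, and every invariant
morphism from `X` to an `S`-scheme factors uniquely through it. -/
def IsCategoricalQuotient (X : GScheme G) {Z : Over S} (π : X.X ⟶ Z) : Prop :=
  X.IsInvariantHom π ∧
    ∀ (T : Over S) (ψ : X.X ⟶ T), X.IsInvariantHom ψ → ∃! χ : Z ⟶ T, π ≫ χ = ψ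

/-- `π : X ⟶ Z` is a universal categorical quotient: it is invariant, and for every `Z' ⟶ Z`
the base change `X ×_Z Z' ⟶ Z'` is a categorical quotient. -/
def IsUniversalCategoricalQuotient (X : GScheme G) {Z : Over S} (π : X.X ⟶ Z) : Prop :=
  ∃ h : X.IsInvariantHom π, ∀ (Z' : Over S) (f : Z' ⟶ Z),
    (X.baseChange π h f).IsCategoricalQuotient (Z := Z') (pullback.snd π f)

/-- `π : X ⟶ Z` is a Zariski locally trivial principal `G`-bundle: it is invariant, and `Z` is
covered by opens `W i` with isomorphisms of `G`-schemes `G × W i ≅ π⁻¹(W i)` over `W i`. -/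
def IsLocallyTrivialPrincipalBundle (X : GScheme G) {Z : Over S} (π : X.X ⟶ Z) : Prop :=
  ∃ h : X.IsInvariantHom π, ∃ (I : Type u) (W : I → Z.left.Opens), (⨆ i, W i) = ⊤ ∧
    ∀ i, ∃ e : trivialGScheme G (openSub Z (W i)) ≅ X.restrict (π.left ⁻¹ᵁ W i) (h.preimage (W i)),
      e.hom.hom ≫ openIncl X.X (π.left ⁻¹ᵁ W i) ≫ π =
        snd G (openSub Z (W i)) ≫ openIncl Z (W i)

end GScheme

end

noncomputable section

open scoped MonObj

/-! ### Actions, orbits and equivariant maps on generalized points -/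

namespace CategoryTheory.Mod

universe v w

variable {C : Type w} [Category.{v} C] [CartesianMonoidalCategory C] {G : C} [GrpObj G]

/-- The action of `Y`-points of `G` on `Y`-points of `X`. -/
def pointSMul (X : Mod C G) {Y : C} (g : Y ⟶ G) (x : Y ⟶ X.X) : Y ⟶ X.X := g • x

section pointSMul

variable (X : Mod C G) {Y : C}

lemma pointSMul_def (g : Y ⟶ G) (x : Y ⟶ X.X) :
    X.pointSMul g x = lift g x ≫ ModObj.smul (M := G) (X := X.X) := rfl

lemma comp_pointSMul {Y' : C} (f : Y' ⟶ Y) (g : Y ⟶ G) (x : Y ⟶ X.X) :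
    f ≫ X.pointSMul g x = X.pointSMul (f ≫ g) (f ≫ x) :=
  ModObj.comp_smul f g x

lemma pointSMul_pointSMul (g h : Y ⟶ G) (x : Y ⟶ X.X) :
    X.pointSMul g (X.pointSMul h x) = X.pointSMul (g * h) x :=
  smul_smul g h x

lemma pointSMul_inv_pointSMul (g : Y ⟶ G) (x : Y ⟶ X.X) :
    X.pointSMul g (X.pointSMul g⁻¹ x) = x :=
  smul_inv_smul g x

end pointSMul

variable {X : Mod C G}

lemma pointSMul_hom {X' : Mod C G} (f : X ⟶ X') {Y : C} (g : Y ⟶ G) (x : Y ⟶ X.X) :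
    X.pointSMul g x ≫ f.hom = X'.pointSMul g (x ≫ f.hom) :=
  IsModHom.map_smul f.hom g x

/-- A morphism that is equivariant on generalized points, as a morphism of modules. -/
def homOfPointSMul {X' : Mod C G} (f : X.X ⟶ X'.X)
    (h : ∀ {Y : C} (g : Y ⟶ G) (x : Y ⟶ X.X),
      X.pointSMul g x ≫ f = X'.pointSMul g (x ≫ f)) : X ⟶ X' :=
  Hom.mk' f <| by
    have := h (fst G X.X) (snd G X.X)
    rw [pointSMul_def, pointSMul_def, lift_fst_snd, Category.id_comp] at this
    rw [this]
    exact congr_arg (· ≫ ModObj.smul (M := G) (X := X'.X)) (show lift _ _ = G ◁ f by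
      apply CartesianMonoidalCategory.hom_ext <;> simp)

/-- An isomorphism that is equivariant on generalized points, as an isomorphism of modules. -/
def isoOfPointSMul {X' : Mod C G} (e : X.X ≅ X'.X)
    (h : ∀ {Y : C} (g : Y ⟶ G) (x : Y ⟶ X.X),
      X.pointSMul g x ≫ e.hom = X'.pointSMul g (x ≫ e.hom)) : X ≅ X' where
  hom := homOfPointSMul e.hom h
  inv := homOfPointSMul e.inv fun g x => by
    rw [← cancel_mono e.hom, Category.assoc, e.inv_hom_id, h, Category.assoc, e.inv_hom_id,
      Category.comp_id, Category.comp_id]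
  hom_inv_id := Mod.hom_ext _ _ e.hom_inv_id
  inv_hom_id := Mod.hom_ext _ _ e.inv_hom_id

variable (X) in
/-- A morphism `ψ : X ⟶ T` is constant on orbits if `ψ (g x) = ψ x` on generalized points. -/
def IsOrbitConstant {T : C} (ψ : X.X ⟶ T) : Prop :=
  ∀ ⦃Y : C⦄ (g : Y ⟶ G) (x : Y ⟶ X.X), X.pointSMul g x ≫ ψ = x ≫ ψ

lemma isOrbitConstant_iff {T : C} (ψ : X.X ⟶ T) :
    X.IsOrbitConstant ψ ↔ ModObj.smul (M := G) (X := X.X) ≫ ψ = snd G X.X ≫ ψ := by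
  refine ⟨fun h => ?_, fun h Y g x => ?_⟩
  · have := h (fst G X.X) (snd G X.X)
    rwa [pointSMul_def, lift_fst_snd, Category.id_comp] at this
  · rw [pointSMul_def, Category.assoc, h, lift_snd_assoc]

lemma IsOrbitConstant.comp {T T' : C} {ψ : X.X ⟶ T} (h : X.IsOrbitConstant ψ) (f : T ⟶ T') :
    X.IsOrbitConstant (ψ ≫ f) := fun Y g x => by
  rw [← Category.assoc, h, Category.assoc]

/-- The morphism `x ↦ σ(x)⁻¹ x`. -/
def normalize (σ : X.X ⟶ G) : X.X ⟶ X.X := X.pointSMul σ⁻¹ (𝟙 X.X)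

lemma comp_normalize (σ : X.X ⟶ G) {Y : C} (a : Y ⟶ X.X) :
    a ≫ normalize σ = X.pointSMul (a ≫ σ)⁻¹ a := by
  rw [normalize, comp_pointSMul, GrpObj.comp_inv, Category.comp_id]

lemma pointSMul_comp_normalize (σ : X.X ⟶ G) {Y : C} (a : Y ⟶ X.X) :
    X.pointSMul (a ≫ σ) (a ≫ normalize σ) = a := by
  rw [comp_normalize, pointSMul_inv_pointSMul]

lemma IsOrbitConstant.normalize_comp {T : C} {ψ : X.X ⟶ T} (h : X.IsOrbitConstant ψ)
    (σ : X.X ⟶ G) : normalize σ ≫ ψ = ψ := by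
  rw [normalize, h, Category.id_comp]

/-- A morphism `σ : X ⟶ G` is equivariant for left multiplication on generalized points. -/
def IsEquivariant (σ : X.X ⟶ G) : Prop :=
  ∀ ⦃Y : C⦄ (g : Y ⟶ G) (x : Y ⟶ X.X), X.pointSMul g x ≫ σ = g * (x ≫ σ)

lemma isEquivariant_hom (σ : X ⟶ Mod.regular G) : IsEquivariant (X := X) (G := G) σ.hom :=
  fun _ g x => pointSMul_hom σ g x

/-- `σ(gx)⁻¹ g x = σ(x)⁻¹ g⁻¹ g x = σ(x)⁻¹ x`. -/
lemma IsEquivariant.isOrbitConstant_normalize {σ : X.X ⟶ G} (h : IsEquivariant σ) :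
    X.IsOrbitConstant (normalize σ) := fun Y g x => by
  rw [comp_normalize, comp_normalize, h, pointSMul_pointSMul, mul_inv_rev, inv_mul_cancel_right]

/-- A splitting of the idempotent `x ↦ σ(x)⁻¹ x` attached to an equivariant morphism `σ`. -/
structure Slice (σ : X.X ⟶ G) where
  /-- The slice. -/
  obj : C
  /-- The inclusion of the slice. -/
  sec : obj ⟶ X.X
  /-- The projection to the slice. -/
  proj : X.X ⟶ obj
  sec_proj : sec ≫ proj = 𝟙 obj
  proj_sec : proj ≫ sec = normalize σ

attribute [simp] Slice.sec_proj

/-- Normalization moves points along orbits and is constant on orbits, so applying it twice is the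
same as applying it once. -/
lemma IsEquivariant.nonempty_slice [IsIdempotentComplete C] {σ : X.X ⟶ G} (h : IsEquivariant σ) :
    Nonempty (Slice σ) := by
  obtain ⟨Z, s, p, h₁, h₂⟩ := IsIdempotentComplete.idempotents_split X.X (normalize σ)
    (h.isOrbitConstant_normalize.normalize_comp σ)
  exact ⟨⟨Z, s, p, h₁, h₂⟩⟩

/-! ### Product decomposition by a slice, and functoriality of slices -/

namespace Slice

variable {σ : X.X ⟶ G} (Q : Slice σ)

instance : Mono Q.sec := mono_of_mono_fac Q.sec_proj

lemma isOrbitConstant_proj (h : IsEquivariant σ) : X.IsOrbitConstant Q.proj := fun Y g x => by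
  rw [← cancel_mono Q.sec, Category.assoc, Category.assoc, Q.proj_sec]
  exact h.isOrbitConstant_normalize g x

lemma proj_sec_comp {T : C} {ψ : X.X ⟶ T} (h : X.IsOrbitConstant ψ) :
    Q.proj ≫ Q.sec ≫ ψ = ψ := by
  rw [← Category.assoc, Q.proj_sec, h.normalize_comp]

lemma pointSMul_proj_sec {Y : C} (a : Y ⟶ X.X) :
    X.pointSMul (a ≫ σ) (a ≫ Q.proj ≫ Q.sec) = a := by
  rw [Q.proj_sec, pointSMul_comp_normalize]

/-- A point `s` of the slice is fixed by normalization, `σ(s)⁻¹ s = s`; applying `σ` gives `1 =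
σ(s)`. -/
lemma sec_comp (h : IsEquivariant σ) : Q.sec ≫ σ = 1 := by
  have h₁ : X.pointSMul (Q.sec ≫ σ)⁻¹ Q.sec = Q.sec := by
    rw [← comp_normalize, ← Q.proj_sec, reassoc_of% Q.sec_proj]
  have h₂ := h (Q.sec ≫ σ)⁻¹ Q.sec
  rwa [h₁, inv_mul_cancel] at h₂

lemma pointSMul_comp_proj (h : IsEquivariant σ) {Y : C} (g : Y ⟶ G) (z : Y ⟶ Q.obj) :
    X.pointSMul g (z ≫ Q.sec) ≫ Q.proj = z := by
  rw [Q.isOrbitConstant_proj h, Category.assoc, Q.sec_proj, Category.comp_id]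

/-- A module with an equivariant morphism to `G` is the product of `G` and the slice. -/
@[simps]
def tensorIso (h : IsEquivariant σ) : G ⊗ Q.obj ≅ X.X where
  hom := X.pointSMul (fst G Q.obj) (snd G Q.obj ≫ Q.sec)
  inv := lift σ Q.proj
  hom_inv_id := by
    rw [comp_lift]
    ext1
    · rw [lift_fst, h, Category.assoc, Q.sec_comp h, MonObj.comp_one, mul_one, Category.id_comp]
    · rw [lift_snd, pointSMul_comp_proj _ h, Category.id_comp]
  inv_hom_id := by
    rw [comp_pointSMul, lift_fst, lift_snd_assoc]
    simpa using Q.pointSMul_proj_sec (𝟙 _)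

section map

variable {X' : Mod C G} {σ' : X'.X ⟶ G} (Q' : Slice σ') (i : X ⟶ X')

/-- The morphism of slices induced by an equivariant morphism. -/
def map : Q.obj ⟶ Q'.obj := Q.sec ≫ i.hom ≫ Q'.proj

/-- The slice `Q` carried by `x ↦ σ'(i(x))⁻¹ x` into the preimage of the slice `Q'`. -/
def mapSec (σ' : X'.X ⟶ G) : Q.obj ⟶ X.X := Q.sec ≫ normalize (i.hom ≫ σ')

lemma mapSec_hom : Q.mapSec i σ' ≫ i.hom = Q.map Q' i ≫ Q'.sec := by
  rw [map, mapSec, Category.assoc, Category.assoc, Category.assoc, Q'.proj_sec, comp_normalize,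
    normalize, pointSMul_hom, Category.id_comp]

lemma mapSec_proj (h : IsEquivariant σ) : Q.mapSec i σ' ≫ Q.proj = 𝟙 _ := by
  rw [mapSec, Category.assoc, (Q.isOrbitConstant_proj h).normalize_comp, Q.sec_proj]

/-- `Q.proj ≫ Q.sec` only moves points along orbits, and `i.hom ≫ Q'.proj` is constant on them. -/
lemma proj_map (h' : IsEquivariant σ') : Q.proj ≫ Q.map Q' i = i.hom ≫ Q'.proj :=
  Q.proj_sec_comp fun Y g x => by
    rw [← Category.assoc, pointSMul_hom, Q'.isOrbitConstant_proj h', Category.assoc]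

/-- If `i(x)` is the point `q'` of the slice `Q'`, projecting `x` to `Q` and returning by `mapSec`
gives, after `i`, again `q'`; as `i` is mono, `x` is recovered. This exhibits the slice map as a
base change of `i`. -/
lemma isPullback_map (h : IsEquivariant σ) (h' : IsEquivariant σ') [Mono i.hom] :
    IsPullback (Q.mapSec i σ') (Q.map Q' i) i.hom Q'.sec := by
  refine ⟨⟨Q.mapSec_hom Q' i⟩, ⟨PullbackCone.IsLimit.mk _ (fun s => s.fst ≫ Q.proj)
    (fun s => ?_) (fun s => ?_) fun s m hm _ => ?_⟩⟩
  · rw [← cancel_mono i.hom, Category.assoc, Category.assoc, Q.mapSec_hom Q' i,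
      reassoc_of% Q.proj_map Q' i h', reassoc_of% s.condition, reassoc_of% Q'.sec_proj, s.condition]
  · rw [Category.assoc, Q.proj_map Q' i h', reassoc_of% s.condition, Q'.sec_proj,
      Category.comp_id]
  · rw [← hm, Category.assoc, Q.mapSec_proj i h, Category.comp_id]

/-- Given `x'` and `q` with the same image in `Q'`, the point `σ'(x') · mapSec(q)` lies over both:
`i` sends it to `σ'(x')` times the normalization of `x'`, which is `x'`. -/
lemma isPullback_proj (h : IsEquivariant σ) (h' : IsEquivariant σ') [Mono i.hom] :
    IsPullback i.hom Q.proj Q'.proj (Q.map Q' i) := by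
  have H : ∀ s : PullbackCone Q'.proj (Q.map Q' i),
      X.pointSMul (s.fst ≫ σ') (s.snd ≫ Q.mapSec i σ') ≫ i.hom = s.fst := fun s => by
    rw [pointSMul_hom, Category.assoc, Q.mapSec_hom Q' i, ← reassoc_of% s.condition,
      Q'.pointSMul_proj_sec]
  refine ⟨⟨(Q.proj_map Q' i h').symm⟩, ⟨PullbackCone.IsLimit.mk _
    (fun s => X.pointSMul (s.fst ≫ σ') (s.snd ≫ Q.mapSec i σ'))
    H (fun s => ?_) fun s m hm _ => ?_⟩⟩
  · rw [Q.isOrbitConstant_proj h, Category.assoc, Q.mapSec_proj i h, Category.comp_id]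
  · rw [← cancel_mono i.hom, hm, H]

lemma map_id : Q.map Q (𝟙 X) = 𝟙 _ := by
  rw [map, Mod.id_hom', Category.id_comp, Q.sec_proj]

lemma map_comp {X'' : Mod C G} {σ'' : X''.X ⟶ G} (Q'' : Slice σ'') (i' : X' ⟶ X'')
    (h'' : IsEquivariant σ'') : Q.map Q'' (i ≫ i') = Q.map Q' i ≫ Q'.map Q'' i' := by
  rw [map, map, Category.assoc, Category.assoc, Q'.proj_map Q'' i' h'', Mod.comp_hom',
    Category.assoc]

end map

end Slice

end CategoryTheory.Mod

/-! ### Invariant opens, base change and gluing of morphisms -/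

namespace GScheme

variable {S : Scheme.{u}} {G : Over S} [GrpObj G]

lemma isInvariantHom_iff (X : GScheme G) {T : Over S} (ψ : X.X ⟶ T) :
    X.IsInvariantHom ψ ↔ X.IsOrbitConstant ψ :=
  (Mod.isOrbitConstant_iff ψ).symm

lemma pointSMul_openIncl (X : GScheme G) {U : X.X.left.Opens} (hU : X.IsInvariant U) {Y : Over S}
    (g : Y ⟶ G) (x : Y ⟶ openSub X.X U) :
    (X.restrict U hU).pointSMul g x ≫ openIncl X.X U = X.pointSMul g (x ≫ openIncl X.X U) := by
  rw [Mod.pointSMul_def, Mod.pointSMul_def, ← lift_whiskerLeft]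
  simp only [Category.assoc]
  exact congr_arg (lift g x ≫ ·) (X.restrictAct_incl U hU)

lemma pointSMul_baseChange_fst (X : GScheme G) {Z Z' : Over S} {π : X.X ⟶ Z}
    (h : X.IsInvariantHom π) (f : Z' ⟶ Z) {Y : Over S} (g : Y ⟶ G) (x : Y ⟶ pullback π f) :
    (X.baseChange π h f).pointSMul g x ≫ pullback.fst π f =
      X.pointSMul g (x ≫ pullback.fst π f) := by
  rw [Mod.pointSMul_def, Mod.pointSMul_def, ← lift_whiskerLeft]
  simp only [Category.assoc]
  exact congr_arg (lift g x ≫ ·) (pullback.lift_fst _ _ _)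

lemma pointSMul_baseChange_snd (X : GScheme G) {Z Z' : Over S} {π : X.X ⟶ Z}
    (h : X.IsInvariantHom π) (f : Z' ⟶ Z) {Y : Over S} (g : Y ⟶ G) (x : Y ⟶ pullback π f) :
    (X.baseChange π h f).pointSMul g x ≫ pullback.snd π f = x ≫ pullback.snd π f := by
  rw [Mod.pointSMul_def, Category.assoc]
  refine (congr_arg (lift g x ≫ ·) (pullback.lift_snd _ _ _)).trans ?_
  simp

lemma pointSMul_trivialGScheme_fst {W Y : Over S} (g : Y ⟶ G) (x : Y ⟶ G ⊗ W) :
    (trivialGScheme G W).pointSMul g x ≫ fst G W = g * (x ≫ fst G W) := by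
  rw [Mod.pointSMul_def, Hom.mul_def]
  change (lift g x ≫ (α_ G G W).inv ≫ MonObj.mul (X := G) ▷ W) ≫ fst G W = _
  simp only [Category.assoc]
  rw [whiskerRight_fst, ← Category.assoc, ← Category.assoc]
  congr 1
  ext1 <;> simp

lemma pointSMul_trivialGScheme_snd {W Y : Over S} (g : Y ⟶ G) (x : Y ⟶ G ⊗ W) :
    (trivialGScheme G W).pointSMul g x ≫ snd G W = x ≫ snd G W := by
  rw [Mod.pointSMul_def]
  change (lift g x ≫ (α_ G G W).inv ≫ MonObj.mul (X := G) ▷ W) ≫ snd G W = _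
  simp

/-- A map into `X` landing in an open subset `U`, as a map to the open subscheme. -/
def openLift {X Y : Over S} (U : X.left.Opens) (a : Y ⟶ X) (h : ∀ y, a.left y ∈ U) :
    Y ⟶ openSub X U :=
  Over.homMk (IsOpenImmersion.lift U.ι a.left (by
    rw [Scheme.Opens.range_ι]; rintro _ ⟨y, rfl⟩; exact h y))
    (by
      rw [← Over.w a]
      exact IsOpenImmersion.lift_fac_assoc U.ι a.left _ X.hom)

@[simp]
lemma openLift_openIncl {X Y : Over S} (U : X.left.Opens) (a : Y ⟶ X) (h : ∀ y, a.left y ∈ U) :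
    openLift U a h ≫ openIncl X U = a := by
  ext1
  exact IsOpenImmersion.lift_fac _ _ _

lemma openIncl_mem {X Y : Over S} {U : X.left.Opens} (a : Y ⟶ openSub X U) (y : Y.left) :
    (a ≫ openIncl X U).left y ∈ U := by
  rw [Over.comp_left, Scheme.Hom.comp_apply]
  exact (a.left y).2

lemma hom_ext_openCover {Z T : Over S} {I : Type*} {W : I → Z.left.Opens}
    (hW : (⨆ i, W i) = ⊤) {f g : Z ⟶ T} (h : ∀ i, openIncl Z (W i) ≫ f = openIncl Z (W i) ≫ g) :
    f = g := by
  ext1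
  refine Scheme.hom_ext_of_forall _ _ fun z => ?_
  obtain ⟨i, hi⟩ := TopologicalSpace.Opens.mem_iSup.mp (hW.ge (Set.mem_univ z))
  exact ⟨W i, hi, congr_arg CommaMorphism.left (h i)⟩

/-- Compatibility is required on generalized points rather than on intersections, which suits
arguments with orbits; it is applied to the two projections of each fibre product of the cover. -/
lemma exists_glue_openCover {Z T : Over S} {I : Type u} {W : I → Z.left.Opens}
    (hW : (⨆ i, W i) = ⊤) (χ : ∀ i, openSub Z (W i) ⟶ T)
    (hχ : ∀ i j (Y : Over S) (a : Y ⟶ openSub Z (W i)) (b : Y ⟶ openSub Z (W j)),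
      a ≫ openIncl Z (W i) = b ≫ openIncl Z (W j) → a ≫ χ i = b ≫ χ j) :
    ∃ f : Z ⟶ T, ∀ i, openIncl Z (W i) ≫ f = χ i := by
  let 𝒰 := Z.left.openCoverOfIsOpenCover W hW
  have H : ∀ i j, pullback.fst (𝒰.f i) (𝒰.f j) ≫ (χ i).left =
      pullback.snd (𝒰.f i) (𝒰.f j) ≫ (χ j).left := fun i j => by
    let Y : Over S := Over.mk (pullback.fst (𝒰.f i) (𝒰.f j) ≫ (W i).ι ≫ Z.hom)
    let a : Y ⟶ openSub Z (W i) := Over.homMk (pullback.fst (𝒰.f i) (𝒰.f j)) rfl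
    let b : Y ⟶ openSub Z (W j) := Over.homMk (pullback.snd (𝒰.f i) (𝒰.f j))
      (pullback.condition_assoc (f := 𝒰.f i) (g := 𝒰.f j) Z.hom).symm
    exact congr_arg CommaMorphism.left (hχ i j Y a b (by
      ext1; exact pullback.condition (f := 𝒰.f i) (g := 𝒰.f j)))
  refine ⟨Over.homMk (𝒰.glueMorphisms (fun i => (χ i).left) H) (𝒰.hom_ext _ _ fun i => ?_),
    fun i => ?_⟩
  · exact (𝒰.ι_glueMorphisms_assoc _ H i T.hom).trans (Over.w (χ i))
  · ext1
    exact 𝒰.ι_glueMorphisms _ H i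

/-- `π : X ⟶ Z` is a trivial principal `G`-bundle over the open subset `W` of `Z`. -/
def IsTrivialOver (X : GScheme G) {Z : Over S} {π : X.X ⟶ Z} (h : X.IsInvariantHom π)
    (W : Z.left.Opens) : Prop :=
  ∃ e : trivialGScheme G (openSub Z W) ≅ X.restrict (π.left ⁻¹ᵁ W) (h.preimage W),
    e.hom.hom ≫ openIncl X.X (π.left ⁻¹ᵁ W) ≫ π = snd G (openSub Z W) ≫ openIncl Z W

/-! ### Locally trivial bundles are universal categorical quotients -/

namespace IsTrivialOver

variable {X : GScheme G} {Z : Over S} {π : X.X ⟶ Z} {h : X.IsInvariantHom π} {W : Z.left.Opens}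

lemma exists_section (H : X.IsTrivialOver h W) :
    ∃ s : openSub Z W ⟶ X.X, s ≫ π = openIncl Z W := by
  obtain ⟨e, he⟩ := H
  -- The unit section `w ↦ (1, w)` of the trivial bundle.
  refine ⟨(lift 1 (𝟙 _) : openSub Z W ⟶ G ⊗ openSub Z W) ≫ e.hom.hom ≫
    openIncl X.X (π.left ⁻¹ᵁ W), ?_⟩
  simp only [Category.assoc]
  exact (congr_arg (_ ≫ ·) he).trans (by simp)

lemma exists_pointSMul_eq (H : X.IsTrivialOver h W) {Y : Over S} (a b : Y ⟶ X.X)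
    (hab : a ≫ π = b ≫ π) (ha : ∀ y, (a ≫ π).left y ∈ W) :
    ∃ g : Y ⟶ G, X.pointSMul g a = b := by
  obtain ⟨e, he⟩ := H
  have key : ∀ a : Y ⟶ X.X, (∀ y, (a ≫ π).left y ∈ W) → ∃ p : Y ⟶ G ⊗ openSub Z W,
      p ≫ (show G ⊗ openSub Z W ⟶ openSub X.X (π.left ⁻¹ᵁ W) from e.hom.hom) ≫
        openIncl X.X (π.left ⁻¹ᵁ W) = a := fun a ha => by
    refine ⟨openLift (π.left ⁻¹ᵁ W) a (fun y => ?_) ≫ e.inv.hom, ?_⟩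
    · have := ha y
      rwa [Over.comp_left, Scheme.Hom.comp_apply] at this
    · have : e.inv.hom ≫ e.hom.hom = 𝟙 _ := congr_arg Mod.Hom.hom e.inv_hom_id
      rw [Category.assoc]
      exact (congr_arg (fun t => openLift (π.left ⁻¹ᵁ W) a _ ≫ t ≫ openIncl X.X _) this).trans
        ((congr_arg (_ ≫ ·) (Category.id_comp _)).trans (openLift_openIncl _ _ _))
  obtain ⟨p, hp⟩ := key a ha
  obtain ⟨q, hq⟩ := key b (hab ▸ ha)
  have hpq : p ≫ snd G (openSub Z W) = q ≫ snd G (openSub Z W) := by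
    have h₁ : a ≫ π = p ≫ snd G (openSub Z W) ≫ openIncl Z W := by
      rw [← he, ← hp]; simp only [Category.assoc]
    have h₂ : b ≫ π = q ≫ snd G (openSub Z W) ≫ openIncl Z W := by
      rw [← he, ← hq]; simp only [Category.assoc]
    rw [← cancel_mono (openIncl Z W), Category.assoc, Category.assoc, ← h₁, ← h₂, hab]
  -- In the trivialization the points are `(p₁, w)` and `(q₁, w)`, so `q₁ p₁⁻¹` carries one to the
  -- other.
  refine ⟨(q ≫ fst _ _) * (p ≫ fst _ _)⁻¹, ?_⟩
  have hg : (trivialGScheme G (openSub Z W)).pointSMul ((q ≫ fst _ _) * (p ≫ fst _ _)⁻¹) p = q := by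
    refine CartesianMonoidalCategory.hom_ext _ _ ?_ ?_
    · refine (pointSMul_trivialGScheme_fst _ _).trans (inv_mul_cancel_right _ _)
    · exact (pointSMul_trivialGScheme_snd _ _).trans hpq
  rw [← hp, ← Category.assoc, ← pointSMul_openIncl X (h.preimage W)]
  conv_rhs => rw [← hq, ← Category.assoc]
  congr 1
  refine (Mod.pointSMul_hom e.hom _ p).symm.trans ?_
  rw [hg]

end IsTrivialOver

lemma IsLocallyTrivialPrincipalBundle.isUniversalCategoricalQuotient {X : GScheme G} {Z : Over S}
    {π : X.X ⟶ Z} (H : X.IsLocallyTrivialPrincipalBundle π) :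
    X.IsUniversalCategoricalQuotient π := by
  obtain ⟨h, I, W, hW, hW'⟩ := H
  replace hW' : ∀ i, X.IsTrivialOver h (W i) := hW'
  refine ⟨h, fun Z' f => ⟨(isInvariantHom_iff _ _).mpr fun Y g x =>
    pointSMul_baseChange_snd X h f g x, fun T ψ hψ => ?_⟩⟩
  replace hψ := (isInvariantHom_iff _ _).mp hψ
  let W' : I → Z'.left.Opens := fun i => f.left ⁻¹ᵁ W i
  have hcov : (⨆ i, W' i) = ⊤ := by
    rw [← Scheme.Hom.preimage_iSup, hW, Scheme.Hom.preimage_top]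
  have mem : ∀ {i} {Y : Over S} (c : Y ⟶ Z'), (∀ y, c.left y ∈ W' i) →
      ∀ y, (c ≫ f).left y ∈ W i := fun c hc y => by
    rw [Over.comp_left, Scheme.Hom.comp_apply]; exact hc y
  -- `ψ` takes the same value on points of `X ×_Z Z'` over the same point of `W' i`
  have orbit : ∀ {i} {Y : Over S} (a b : Y ⟶ pullback π f),
      a ≫ pullback.snd π f = b ≫ pullback.snd π f →
      (∀ y, (a ≫ pullback.snd π f).left y ∈ W' i) → a ≫ ψ = b ≫ ψ := fun {i Y} a b hab ha => by
    obtain ⟨g, hg⟩ := (hW' i).exists_pointSMul_eq (a ≫ pullback.fst π f) (b ≫ pullback.fst π f)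
      (by simp only [Category.assoc, pullback.condition]; rw [reassoc_of% hab])
      (by simpa only [Category.assoc, pullback.condition] using mem _ ha)
    have : (X.baseChange π h f).pointSMul g a = b := by
      apply pullback.hom_ext
      · exact (pointSMul_baseChange_fst X h f g a).trans hg
      · exact (pointSMul_baseChange_snd X h f g a).trans hab
    rw [← this]
    exact (hψ g a).symm
  have sec : ∀ i, ∃ s : openSub Z' (W' i) ⟶ pullback π f,
      s ≫ pullback.snd π f = openIncl Z' (W' i) := fun i => by
    obtain ⟨s, hs⟩ := (hW' i).exists_section
    let r : openSub Z' (W' i) ⟶ openSub Z (W i) :=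
      openLift (W i) (openIncl Z' (W' i) ≫ f) (mem _ fun y => y.2)
    exact ⟨pullback.lift (r ≫ s) (openIncl Z' (W' i)) (by simp [r, hs]), pullback.lift_snd _ _ _⟩
  choose s hs using sec
  -- On each `W' i` the descended map must be `ψ` along the section; two sections differ by a point
  -- of `G`, which `ψ` ignores.
  obtain ⟨χ, hχ⟩ := exists_glue_openCover hcov (fun i => s i ≫ ψ) fun i j Y a b hab => by
    simp only [← Category.assoc]
    exact orbit (i := i) _ _ (by simpa [hs] using hab) fun y => by
      rw [Category.assoc, hs]; exact openIncl_mem a y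
  refine ⟨χ, ?_, fun χ' hχ' => ?_⟩
  · have hcov' : (⨆ i, (pullback.snd π f).left ⁻¹ᵁ W' i) = ⊤ := by
      rw [← Scheme.Hom.preimage_iSup, hcov, Scheme.Hom.preimage_top]
    -- A point over `W' i` and the section at its image lie in one fibre, so `ψ` agrees on them.
    refine hom_ext_openCover hcov' fun i => ?_
    let r : openSub (pullback π f) ((pullback.snd π f).left ⁻¹ᵁ W' i) ⟶ openSub Z' (W' i) :=
      openLift (W' i) (openIncl _ _ ≫ pullback.snd π f) fun y => by
        rw [Over.comp_left, Scheme.Hom.comp_apply]; exact y.2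
    have hr : r ≫ openIncl Z' (W' i) = openIncl _ _ ≫ pullback.snd π f :=
      openLift_openIncl _ _ _
    rw [← reassoc_of% hr, hχ, ← Category.assoc]
    refine orbit (i := i) _ _ ?_ ?_
    · rw [Category.assoc, hs, hr]
    · rw [Category.assoc, hs]; exact openIncl_mem r
  · refine hom_ext_openCover hcov fun i => ?_
    rw [hχ, ← hs i, Category.assoc]
    exact congr_arg (s i ≫ ·) hχ'

/-- A morphism is a trivial bundle over `W` as soon as its restriction to the preimage `V` of `W`
is the projection to a slice. -/
lemma isTrivialOver_of_slice {X : GScheme G} {Z : Over S} {π : X.X ⟶ Z} (h : X.IsInvariantHom π)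
    {W : Z.left.Opens} {V : X.X.left.Opens} (hV : V = π.left ⁻¹ᵁ W) (hinv : X.IsInvariant V)
    {σ : (X.restrict V hinv).X ⟶ G} (hσ : Mod.IsEquivariant σ) (Q : Mod.Slice σ)
    (j : Q.obj ≅ openSub Z W) (hj : Q.proj ≫ j.hom ≫ openIncl Z W = openIncl X.X V ≫ π) :
    X.IsTrivialOver h W := by
  -- `V` is kept as a variable because its slice is chosen before `Z` and `π` exist.
  subst hV
  let e : G ⊗ openSub Z W ≅ (X.restrict (π.left ⁻¹ᵁ W) hinv).X :=
    (whiskerLeftIso G j.symm) ≪≫ Q.tensorIso hσ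
  have he : e.hom = (X.restrict (π.left ⁻¹ᵁ W) hinv).pointSMul (fst _ _)
      (snd _ _ ≫ j.inv ≫ Q.sec) := by
    simp only [e, Iso.trans_hom, Mod.Slice.tensorIso_hom, Mod.comp_pointSMul]
    simp
  refine ⟨Mod.isoOfPointSMul (X := trivialGScheme G (openSub Z W)) e fun g x => ?_, ?_⟩
  · rw [he, Mod.comp_pointSMul, Mod.comp_pointSMul, Mod.pointSMul_pointSMul]
    congr 1
    · exact pointSMul_trivialGScheme_fst g x
    · simp only [← Category.assoc]
      exact congr_arg (fun t => (t ≫ j.inv) ≫ Q.sec) (pointSMul_trivialGScheme_snd g x)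
  · change e.hom ≫ openIncl X.X (π.left ⁻¹ᵁ W) ≫ π = _
    rw [← hj, he, ← Category.assoc, ← Category.assoc (snd _ _), Q.pointSMul_comp_proj hσ]
    simp

/-- The `G`-invariant open subschemes of `X` that admit an equivariant morphism to `G`. -/
def TrivializableOpens (X : GScheme G) : Type u :=
  {V : X.X.left.Opens // ∃ h : X.IsInvariant V, Nonempty (X.restrict V h ⟶ leftMul G)}

/-- The inclusion of an invariant open subscheme in another one. -/
def restrictLE (X : GScheme G) {V V' : X.X.left.Opens} (h : X.IsInvariant V)
    (h' : X.IsInvariant V') (hV : V ≤ V') : X.restrict V h ⟶ X.restrict V' h' :=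
  let i : openSub X.X V ⟶ openSub X.X V' := Over.homMk (X.X.left.homOfLE hV)
  have hi : i ≫ openIncl X.X V' = openIncl X.X V := by ext1; exact X.X.left.homOfLE_ι hV
  Mod.homOfPointSMul (X := X.restrict V h) (X' := X.restrict V' h') i fun g x => by
    rw [← cancel_mono (openIncl X.X V')]
    refine (Category.assoc _ _ _).trans ?_
    rw [hi, pointSMul_openIncl X h, pointSMul_openIncl X h', Category.assoc, hi]

lemma restrictLE_openIncl (X : GScheme G) {V V' : X.X.left.Opens} (h : X.IsInvariant V)
    (h' : X.IsInvariant V') (hV : V ≤ V') :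
    (X.restrictLE h h' hV).hom ≫ (show (X.restrict V' h').X ⟶ X.X from openIncl X.X V') =
      openIncl X.X V :=
  Over.OverMorphism.ext (X.X.left.homOfLE_ι hV)

/-! ### The poset of trivializable opens and its diagram of slices -/

namespace TrivializableOpens

variable {X : GScheme G}

instance : PartialOrder X.TrivializableOpens := inferInstanceAs (PartialOrder (Subtype _))

lemma isInvariant (V : X.TrivializableOpens) : X.IsInvariant V.1 := V.2.choose

/-- The open subscheme with its action of `G`. -/
def gScheme (V : X.TrivializableOpens) : GScheme G := X.restrict V.1 V.isInvariant

/-- The inclusion in `X`. -/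
def incl (V : X.TrivializableOpens) : V.gScheme.X ⟶ X.X := openIncl X.X V.1

instance (V : X.TrivializableOpens) : Mono V.incl := inferInstanceAs (Mono (openIncl X.X V.1))

instance (V : X.TrivializableOpens) : IsOpenImmersion V.incl.left :=
  inferInstanceAs (IsOpenImmersion V.1.ι)

/-- An equivariant morphism to `G`. -/
def toGroup (V : X.TrivializableOpens) : V.gScheme.X ⟶ G := V.2.choose_spec.some.hom

lemma isEquivariant_toGroup (V : X.TrivializableOpens) : Mod.IsEquivariant V.toGroup :=
  Mod.isEquivariant_hom V.2.choose_spec.some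

lemma nonempty_slice (V : X.TrivializableOpens) : Nonempty (Mod.Slice V.toGroup) :=
  -- An idempotent splits through its equalizer with the identity.
  have : IsIdempotentComplete (Over S) :=
    (Idempotents.isIdempotentComplete_iff_hasEqualizer_of_id_and_idempotent _).mpr
      fun _ _ _ => inferInstance
  V.isEquivariant_toGroup.nonempty_slice

/-- A slice of the action. -/
def slice (V : X.TrivializableOpens) : Mod.Slice V.toGroup := V.nonempty_slice.some

/-- The inclusion of an open subscheme in another one. -/
def homOfLE {V V' : X.TrivializableOpens} (h : V ≤ V') : V.gScheme ⟶ V'.gScheme :=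
  X.restrictLE V.isInvariant V'.isInvariant h

@[simp]
lemma homOfLE_incl {V V' : X.TrivializableOpens} (h : V ≤ V') :
    (homOfLE h).hom ≫ V'.incl = V.incl :=
  X.restrictLE_openIncl V.isInvariant V'.isInvariant h

instance {V V' : X.TrivializableOpens} (h : V ≤ V') : Mono (homOfLE h).hom :=
  mono_of_mono_fac (homOfLE_incl h)

instance {V V' : X.TrivializableOpens} (h : V ≤ V') : IsOpenImmersion (homOfLE h).hom.left :=
  inferInstanceAs (IsOpenImmersion (X.X.left.homOfLE (show V.1 ≤ V'.1 from h)))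

lemma pointSMul_incl (V : X.TrivializableOpens) {Y : Over S} (g : Y ⟶ G) (x : Y ⟶ V.gScheme.X) :
    V.gScheme.pointSMul g x ≫ V.incl = X.pointSMul g (x ≫ V.incl) :=
  pointSMul_openIncl X V.isInvariant g x

lemma exists_incl_eq (V : X.TrivializableOpens) {x : X.X.left} (hx : x ∈ V.1) :
    ∃ y, V.incl.left y = x := ⟨⟨x, hx⟩, rfl⟩

lemma incl_mem (V : X.TrivializableOpens) (y : V.gScheme.X.left) : V.incl.left y ∈ V.1 := y.2

/-- The morphism of slices induced by an inclusion. -/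
def sliceMap {V V' : X.TrivializableOpens} (h : V ≤ V') : V.slice.obj ⟶ V'.slice.obj :=
  V.slice.map V'.slice (homOfLE h)

lemma proj_sliceMap {V V' : X.TrivializableOpens} (h : V ≤ V') :
    V.slice.proj ≫ sliceMap h = (homOfLE h).hom ≫ V'.slice.proj :=
  V.slice.proj_map V'.slice _ V'.isEquivariant_toGroup

instance {V V' : X.TrivializableOpens} (h : V ≤ V') : IsOpenImmersion (sliceMap h).left :=
  MorphismProperty.of_isPullback (P := @IsOpenImmersion)
    ((V.slice.isPullback_map V'.slice (homOfLE h) V.isEquivariant_toGroup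
      V'.isEquivariant_toGroup).map (Over.forget S))
    (inferInstanceAs (IsOpenImmersion (homOfLE h).hom.left))

/-- The diagram of slices. -/
@[simps]
def sliceFunctor (X : GScheme G) : X.TrivializableOpens ⥤ Over S where
  obj V := V.slice.obj
  map f := sliceMap (leOfHom f)
  map_id V := by
    rw [← V.slice.map_id, sliceMap]
    congr 1
    ext1
    rw [← cancel_mono V.incl]
    simp
  map_comp {V V' V''} f g := by
    rw [sliceMap, sliceMap, sliceMap, ← V.slice.map_comp _ _ _ _ V''.isEquivariant_toGroup]
    congr 1
    ext1
    rw [← cancel_mono V''.incl]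
    simp

/-- An equivariant map restricts to the intersection. The map `toGroup` selected there need not be
compatible with those of `V` and `V'`. -/
instance : Min X.TrivializableOpens where
  min V V' := ⟨V.1 ⊓ V'.1, by
    have hinv : X.IsInvariant (V.1 ⊓ V'.1) := fun y hy =>
      ⟨V.isInvariant hy.1, V'.isInvariant hy.2⟩
    exact ⟨hinv, ⟨X.restrictLE hinv V.isInvariant inf_le_left ≫ V.2.choose_spec.some⟩⟩⟩

lemma inf_le_left' (V V' : X.TrivializableOpens) : min V V' ≤ V :=
  inf_le_left (a := V.1)

lemma inf_le_right' (V V' : X.TrivializableOpens) : min V V' ≤ V' :=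
  inf_le_right (a := V.1)

/-- The diagram of slices, as schemes. -/
abbrev schemeFunctor (X : GScheme G) : X.TrivializableOpens ⥤ Scheme.{u} :=
  sliceFunctor X ⋙ Over.forget S

instance {V V' : X.TrivializableOpens} (f : V ⟶ V') :
    IsOpenImmersion ((schemeFunctor X).map f) :=
  inferInstanceAs (IsOpenImmersion (sliceMap (leOfHom f)).left)

/-- Saturation of `V` in `V'` at the level of points: a fibre product of schemes surjects onto the
fibre product of the underlying sets. -/
lemma exists_of_sliceMap_eq {V V' : X.TrivializableOpens} (h : V ≤ V') (x : V'.gScheme.X.left)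
    (z : V.slice.obj.left) (hz : (sliceMap h).left z = V'.slice.proj.left x) :
    ∃ y, (homOfLE h).hom.left y = x ∧ V.slice.proj.left y = z :=
  Scheme.exists_preimage_of_isPullback
    ((V.slice.isPullback_proj V'.slice (homOfLE h) V.isEquivariant_toGroup
      V'.isEquivariant_toGroup).map (Over.forget S)) x z hz.symm

lemma slice_proj_surjective (V : X.TrivializableOpens) (z : V.slice.obj.left) :
    ∃ y, V.slice.proj.left y = z :=
  ⟨V.slice.sec.left z, by
    rw [← Scheme.Hom.comp_apply, ← Over.comp_left, V.slice.sec_proj]; rfl⟩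

lemma sliceMap_proj_apply {V V' : X.TrivializableOpens} (h : V ≤ V') (y : V.gScheme.X.left) :
    (sliceMap h).left (V.slice.proj.left y) = V'.slice.proj.left ((homOfLE h).hom.left y) := by
  rw [← Scheme.Hom.comp_apply, ← Over.comp_left, proj_sliceMap, Over.comp_left,
    Scheme.Hom.comp_apply]

lemma incl_homOfLE {V V' : X.TrivializableOpens} (h : V ≤ V') (y : V.gScheme.X.left) :
    V'.incl.left ((homOfLE h).hom.left y) = V.incl.left y := by
  rw [← Scheme.Hom.comp_apply, ← Over.comp_left, homOfLE_incl]

lemma incl_injective (V : X.TrivializableOpens) : Function.Injective V.incl.left :=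
  V.incl.left.isOpenEmbedding.injective

/-- Lift `z₁` to a point of `V₁`. Its image in the slice of `V` comes from `V₂`, so by saturation
the point lies in `V₂` too; project it from the intersection. -/
lemma exists_sliceMap_inf_eq {V₁ V₂ V : X.TrivializableOpens} (h₁ : V₁ ≤ V) (h₂ : V₂ ≤ V)
    (z₁ : V₁.slice.obj.left) (z₂ : V₂.slice.obj.left)
    (h : (sliceMap h₁).left z₁ = (sliceMap h₂).left z₂) :
    ∃ z, (sliceMap (inf_le_left' V₁ V₂)).left z = z₁ ∧
      (sliceMap (inf_le_right' V₁ V₂)).left z = z₂ := by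
  obtain ⟨y₁, rfl⟩ := V₁.slice_proj_surjective z₁
  rw [sliceMap_proj_apply] at h
  obtain ⟨y₂, hy₂, rfl⟩ := exists_of_sliceMap_eq h₂ _ _ h.symm
  have hy : V₂.incl.left y₂ = V₁.incl.left y₁ := by
    rw [← incl_homOfLE h₂, hy₂, incl_homOfLE]
  obtain ⟨y, hy'⟩ := (min V₁ V₂).exists_incl_eq (x := V₁.incl.left y₁)
    ⟨V₁.incl_mem y₁, hy ▸ V₂.incl_mem y₂⟩
  refine ⟨(min V₁ V₂).slice.proj.left y, ?_, ?_⟩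
  · rw [sliceMap_proj_apply]
    refine congr_arg V₁.slice.proj.left (V₁.incl_injective ?_)
    rw [incl_homOfLE, hy']
  · rw [sliceMap_proj_apply]
    refine congr_arg V₂.slice.proj.left (V₂.incl_injective ?_)
    rw [incl_homOfLE, hy', hy]

instance : (schemeFunctor X ⋙ Scheme.forget).IsLocallyDirected where
  cond {V₁ V₂ V} f₁ f₂ z₁ z₂ h := by
    obtain ⟨z, hz₁, hz₂⟩ := exists_sliceMap_inf_eq (leOfHom f₁) (leOfHom f₂) z₁ z₂ h
    exact ⟨min V₁ V₂, CategoryTheory.homOfLE (inf_le_left' V₁ V₂),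
      CategoryTheory.homOfLE (inf_le_right' V₁ V₂), z, hz₁, hz₂⟩

end TrivializableOpens

/-! ### The quotient as the gluing of the slices -/

namespace TrivializableOpens

variable (X : GScheme G)

/-- The gluing of the slices. -/
def quotient : Over S :=
  Over.mk (colimit.desc (schemeFunctor X)
    ⟨S, { app := fun V => V.slice.obj.hom
          naturality := fun _ _ f =>
            (Over.w (sliceMap (leOfHom f))).trans (Category.comp_id _).symm }⟩)

variable {X}

/-- The inclusion of a slice in the quotient. -/
def toQuotient (V : X.TrivializableOpens) : V.slice.obj ⟶ quotient X :=
  Over.homMk (colimit.ι (schemeFunctor X) V) (colimit.ι_desc _ _)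

instance (V : X.TrivializableOpens) : IsOpenImmersion V.toQuotient.left :=
  inferInstanceAs (IsOpenImmersion (colimit.ι (schemeFunctor X) V))

lemma sliceMap_toQuotient {V V' : X.TrivializableOpens} (h : V ≤ V') :
    sliceMap h ≫ V'.toQuotient = V.toQuotient :=
  Over.OverMorphism.ext (colimit.w (schemeFunctor X) (CategoryTheory.homOfLE h))

lemma toQuotient_jointly_surjective (z : (quotient X).left) :
    ∃ (V : X.TrivializableOpens) (y : V.slice.obj.left), V.toQuotient.left y = z :=
  Scheme.IsLocallyDirected.ι_jointly_surjective (schemeFunctor X) z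

lemma exists_of_toQuotient_eq {V V' : X.TrivializableOpens} {z : V.slice.obj.left}
    {z' : V'.slice.obj.left} (h : V.toQuotient.left z = V'.toQuotient.left z') :
    ∃ (V₀ : X.TrivializableOpens) (h₁ : V₀ ≤ V) (h₂ : V₀ ≤ V') (z₀ : V₀.slice.obj.left),
      (sliceMap h₁).left z₀ = z ∧ (sliceMap h₂).left z₀ = z' := by
  obtain ⟨V₀, f₁, f₂, z₀, hz, hz'⟩ :=
    (Scheme.IsLocallyDirected.ι_eq_ι_iff (schemeFunctor X)).mp h
  exact ⟨V₀, leOfHom f₁, leOfHom f₂, z₀, hz, hz'⟩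

lemma homOfLE_proj_toQuotient {V V' : X.TrivializableOpens} (h : V ≤ V') :
    (homOfLE h).hom ≫ V'.slice.proj ≫ V'.toQuotient = V.slice.proj ≫ V.toQuotient := by
  rw [← reassoc_of% proj_sliceMap h, sliceMap_toQuotient]

/-- A map into two trivializable open subschemes lands in their intersection. -/
lemma exists_lift_inf {V V' : X.TrivializableOpens} {Y : Over S} (a : Y ⟶ V.gScheme.X)
    (b : Y ⟶ V'.gScheme.X) (hab : a ≫ V.incl = b ≫ V'.incl) :
    ∃ c : Y ⟶ (min V V').gScheme.X, c ≫ (homOfLE (inf_le_left' V V')).hom = a ∧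
      c ≫ (homOfLE (inf_le_right' V V')).hom = b := by
  obtain ⟨c, hc⟩ : ∃ c : Y ⟶ (min V V').gScheme.X, c ≫ (min V V').incl = a ≫ V.incl :=
    ⟨_, openLift_openIncl (min V V').1 (a ≫ V.incl) fun y =>
      ⟨openIncl_mem a y, by rw [hab]; exact openIncl_mem b y⟩⟩
  refine ⟨c, ?_, ?_⟩
  · rw [← cancel_mono V.incl, Category.assoc, homOfLE_incl, hc]
  · rw [← cancel_mono V'.incl, Category.assoc, homOfLE_incl, hc, hab]

lemma exists_quotient_hom (hX : (⨆ V : X.TrivializableOpens, V.1) = ⊤) :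
    ∃ π : X.X ⟶ quotient X, ∀ V : X.TrivializableOpens,
      V.incl ≫ π = V.slice.proj ≫ V.toQuotient :=
  exists_glue_openCover hX (fun V => V.slice.proj ≫ V.toQuotient) fun V V' Y a b hab => by
    obtain ⟨c, rfl, rfl⟩ := exists_lift_inf (V := V) (V' := V') a b hab
    refine (Category.assoc _ _ _).trans (Eq.trans ?_ (Category.assoc _ _ _).symm)
    exact congr_arg (c ≫ ·) ((homOfLE_proj_toQuotient (inf_le_left' V V')).trans
      (homOfLE_proj_toQuotient (inf_le_right' V V')).symm)

section

variable (hX : (⨆ V : X.TrivializableOpens, V.1) = ⊤) {π : X.X ⟶ quotient X}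
  (hπ : ∀ V : X.TrivializableOpens, V.incl ≫ π = V.slice.proj ≫ V.toQuotient)

include hX hπ

lemma isInvariantHom_of_incl_comp : X.IsInvariantHom π := by
  refine (isInvariantHom_iff _ _).mpr fun Y g x => ?_
  -- Invariance is local on the test scheme, which is covered by the loci where `x` lands in a
  -- trivializable open.
  refine hom_ext_openCover (W := fun V : X.TrivializableOpens => x.left ⁻¹ᵁ V.1) ?_ fun V => ?_
  · rw [← Scheme.Hom.preimage_iSup, hX, Scheme.Hom.preimage_top]
  · let y : openSub Y (x.left ⁻¹ᵁ V.1) ⟶ V.gScheme.X :=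
      openLift V.1 (openIncl Y _ ≫ x) fun y => y.2
    have hy : y ≫ V.incl = openIncl Y _ ≫ x := openLift_openIncl _ _ _
    rw [← Category.assoc, ← Category.assoc, Mod.comp_pointSMul, ← hy, ← V.pointSMul_incl,
      Category.assoc, Category.assoc, hπ,
      ((V.slice.isOrbitConstant_proj V.isEquivariant_toGroup).comp _) _ y]

lemma eq_preimage_opensRange (V : X.TrivializableOpens) :
    V.1 = π.left ⁻¹ᵁ V.toQuotient.left.opensRange := by
  have happ : ∀ (V : X.TrivializableOpens) (y : V.gScheme.X.left),
      π.left (V.incl.left y) = V.toQuotient.left (V.slice.proj.left y) := fun V y => by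
    rw [← Scheme.Hom.comp_apply, ← Scheme.Hom.comp_apply, ← Over.comp_left, hπ, Over.comp_left]
  apply le_antisymm
  · intro x hx
    obtain ⟨y, rfl⟩ := V.exists_incl_eq hx
    exact ⟨V.slice.proj.left y, (happ V y).symm⟩
  · rintro x ⟨z, hz⟩
    obtain ⟨V', hx⟩ := TopologicalSpace.Opens.mem_iSup.mp (hX.ge (Set.mem_univ x))
    obtain ⟨y, rfl⟩ := V'.exists_incl_eq hx
    -- Points of two slices agree in the gluing only through a common smaller `V₀`; saturation of
    -- `V₀` in `V'` puts the given point in `V₀`, hence in `V`.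
    obtain ⟨V₀, h₁, h₂, z₀, -, hz'⟩ := exists_of_toQuotient_eq (hz.trans (happ V' y))
    obtain ⟨y₀, rfl, -⟩ := exists_of_sliceMap_eq h₂ y z₀ hz'
    rw [incl_homOfLE]
    exact h₁ (V₀.incl_mem y₀)

lemma isLocallyTrivialPrincipalBundle : X.IsLocallyTrivialPrincipalBundle π := by
  have h := isInvariantHom_of_incl_comp hX hπ
  refine ⟨h, X.TrivializableOpens, fun V => V.toQuotient.left.opensRange, ?_, fun V => ?_⟩
  · refine top_le_iff.mp fun z _ => ?_
    obtain ⟨V, y, hy⟩ := toQuotient_jointly_surjective z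
    exact TopologicalSpace.Opens.mem_iSup.mpr ⟨V, y, hy⟩
  · have hw : V.toQuotient.left.isoOpensRange.hom ≫ V.toQuotient.left.opensRange.ι =
        V.toQuotient.left := V.toQuotient.left.isoOpensRange_hom_ι
    let j : V.slice.obj ≅ openSub (quotient X) V.toQuotient.left.opensRange :=
      Over.isoMk V.toQuotient.left.isoOpensRange (by
        change _ ≫ _ ≫ _ = _
        rw [reassoc_of% hw, Over.w])
    have hj : j.hom ≫ openIncl _ _ = V.toQuotient := Over.OverMorphism.ext hw
    exact isTrivialOver_of_slice h (eq_preimage_opensRange hX hπ V) V.isInvariant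
      V.isEquivariant_toGroup V.slice j (by rw [hj]; exact (hπ V).symm)

end

end TrivializableOpens

end GScheme

end

theorem mainTheorem8 {S : Scheme.{u}} (G : Over S) [GrpObj G] [IsAffineHom G.hom] [Flat G.hom]
    (X : GScheme G) [IsSeparated X.X.hom] {I : Type*} (U : I → X.X.left.Opens)
    (hcover : (⨆ i, U i) = ⊤) (haff : ∀ i, IsAffineOpen (U i))
    (hinv : ∀ i, X.IsInvariant (U i))
    (hσ : ∀ i, Nonempty (X.restrict (U i) (hinv i) ⟶ GScheme.leftMul G)) :
    ∃ (Z : Over S) (π : X.X ⟶ Z),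
      X.IsUniversalCategoricalQuotient π ∧ X.IsLocallyTrivialPrincipalBundle π := by
  -- Each `U i` is itself trivializable, so enlarging the cover to all trivializable opens keeps it
  -- a cover and makes it stable under intersection.
  have hX : (⨆ V : X.TrivializableOpens, V.1) = ⊤ :=
    top_le_iff.mp (hcover ▸ iSup_le fun i =>
      le_iSup (fun V : X.TrivializableOpens => V.1) ⟨U i, hinv i, hσ i⟩)
  obtain ⟨π, hπ⟩ := GScheme.TrivializableOpens.exists_quotient_hom hX
  have h := GScheme.TrivializableOpens.isLocallyTrivialPrincipalBundle hX hπ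
  exact ⟨_, π, h.isUniversalCategoricalQuotient, h⟩
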